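/- All graphs are finite and simple. For a graph $G$ let $\alpha(G)$ be its independence number and let $\theta(G)$ be its clique cover number, that is, the minimum number of cliques whose union is $V(G)$. A set $X\subseteq V(G)$ is dominating if every vertex outside $X$ has a neighbour in $X$. Guards occupy the vertices of a dominating set $X$, at most one guard per vertex, and must respond to an infinite sequence of attacks, revealed one at a time: when an unoccupied vertex $u$ is attacked, exactly one guard on a neighbour of $u$ moves along the edge to $u$, and the resulting set of occupied vertices must again be dominating (an attack on an occupied vertex requires no move). The eternal domination number $\gamma^\infty(G)$ is the minimum $k$ such that $k$ guards, starting from a suitable set of $k$ vertices, can respond in this way to any infinite sequence of attacks. Let $G\,\Box\,K_2$ denote the prism of $G$, i.e. the Cartesian product of $G$ with the complete graph $K_2$. **Theorem.** For every integer $k\ge 2$ there is a graph $G$ such that $$\alpha(G)=\gamma^\infty(G)=\theta(G)=\binom{k+1}{2}+1\quad\text{and}\quad \alpha(G\,\Box\,K_2)=\gamma^\infty(G\,\Box\,K_2)<\theta(G\,\Box\,K_2).$$ Consequently there are infinitely many pairwise non-isomorphic graphs $G$ with $\gamma^\infty(G)=\theta(G)$ and $\gamma^\infty(G\,\Box\,K_2)<\theta(G\,\Box\,K_2)$,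 that is, infinitely many counterexamples to the conjecture of Klostermeyer and Mynhardt that $\gamma^\infty(G)=\theta(G)$ implies $\gamma^\infty(G\,\Box\,K_2)=\theta(G\,\Box\,K_2)$. -/

import Mathlib

namespace EternalDomination

variable {V : Type*}

/-- A set `X` of vertices is dominating if every vertex outside `X` has a neighbour in `X`. -/
def IsDominating (G : SimpleGraph V) (X : Finset V) : Prop :=
  ∀ u, u ∉ X → ∃ x ∈ X, G.Adj x u

/-- `Y` arises from the guard positions `X` by moving exactly one guard along an edge of `G`
to the vertex `u`. -/
def GuardMove (G : SimpleGraph V) (X : Finset V) (u : V) (Y : Finset V) : Prop :=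
  ∃ x ∈ X, G.Adj x u ∧ (Y : Set V) = insert u ((X : Set V) \ {x})

/-- A defence strategy starting from the guard positions `X`. The value `S h` is the set of
occupied vertices after the finite sequence `h` of attacks, the most recent attack being the head
of the list; so a response may depend on the past but not on future attacks. The positions are
always a dominating set, an attack on an unoccupied vertex is answered by moving one guard to it
along an edge, and an attack on an occupied vertex moves no guard. As this holds for every finite
sequence of attacks, the strategy answers every infinite sequence of attacks. -/
structure IsDefence (G : SimpleGraph V) (X : Finset V) (S : List V → Finset V) : Prop where
  start : S [] = X
  dominating : ∀ h, IsDominating G (S h)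
  move : ∀ h u, u ∉ S h → GuardMove G (S h) u (S (u :: h))
  stay : ∀ h u, u ∈ S h → S (u :: h) = S h

/-- `G` can be eternally `k`-guarded: `k` guards on distinct vertices can respond to any infinite
sequence of attacks. -/
def EternallyGuarded (G : SimpleGraph V) (k : ℕ) : Prop :=
  ∃ (X : Finset V) (S : List V → Finset V), X.card = k ∧ IsDefence G X S

/-- The eternal domination number of a finite graph. -/
noncomputable def eternalDominationNum (G : SimpleGraph V) : ℕ :=
  sInf {k | EternallyGuarded G k}

/-- A clique cover: a finite set of cliques whose union is the vertex set. -/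
def IsCliqueCover (G : SimpleGraph V) (C : Finset (Set V)) : Prop :=
  (∀ X ∈ C, G.IsClique X) ∧ ⋃ X ∈ C, X = Set.univ

/-- The clique cover number of a finite graph. -/
noncomputable def cliqueCoverNum (G : SimpleGraph V) : ℕ :=
  sInf {k | ∃ C : Finset (Set V), IsCliqueCover G C ∧ C.card = k}

/-- The prism `G □ K₂`. -/
abbrev prism (G : SimpleGraph V) : SimpleGraph (V × Fin 2) :=
  G.boxProd (SimpleGraph.completeGraph (Fin 2))

end EternalDomination

/-!
The counterexamples are joins. Let `m ≥ 4`, let `H` be a triangle-free graph with chromatic number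
`m` (an iterated Mycielskian), and let `G` be the join of `Hᶜ` with an edgeless graph on a set `K`
of `m - 1` vertices and an edgeless graph on a set `I` of `m` vertices. Equivalently, `G` is the
complement of the disjoint sum of `H` and two complete graphs. An `m`-colouring of this sum
partitions `G` into `m` cliques, and `I` is independent, so `α = γ^∞ = θ = m`.

In the prism, one copy of `I` together with the other copy of `K` is an independent set of size
`2m - 1`. On the other hand `2m` cliques are needed to cover it: a clique meets one copy of `I` in
at most one vertex, at least `m` cliques are needed for the other copy of `Hᶜ` since `H` has
chromatic number `m`, and no clique is counted twice, as no vertex of the first copy of `I` is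
adjacent to one of the second copy of `Hᶜ` (`card_add_lt_of_isCliqueCover_prism`).

It remains to defend the prism with `2m - 1` guards. Let `F` be the join of `Hᶜ` with `K`. In `F`
alone, `m - 1` guards suffice as long as they do not form a clique of `Hᶜ`, because `H` is
triangle-free, that is, `Hᶜ` has independence number at most two (`exists_answer_guardSets`).
In the prism, the invariant `Safe` is maintained: one copy of `G` carries `m - 1` guards and the
other `m`, each copy of `F` has at least as many guards as there are vertices of `I` unoccupied in
both copies, and a copy of `F` with `m - 1` guards is defended by the strategy for `F`. Attacks on
`F` and on `I` are answered by `Safe.exists_answer_left` and `Safe.exists_answer_right`.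
-/

namespace EternalDomination

open Finset SimpleGraph

/-! ### General bounds on the eternal domination number and the clique cover number -/

section General

variable {V : Type*} {G : SimpleGraph V}

/-- Guards can defend a graph forever if their positions stay in a family of vertex sets in which
every attack has an answer. Domination of the positions is automatic, since an attack on an
undominated vertex would have no answer. -/
theorem eternallyGuarded_of_closed_family [DecidableEq V] (𝓕 : Set (Finset V))
    (h𝓕 : ∀ X ∈ 𝓕, ∀ u ∉ X, ∃ x ∈ X, G.Adj x u ∧ insert u (X.erase x) ∈ 𝓕)
    {X : Finset V} (hX : X ∈ 𝓕) : EternallyGuarded G X.card := by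
  choose! f hfX hfG hf𝓕 using h𝓕
  let S : List V → Finset V := fun l =>
    l.foldr (fun u Y => if u ∈ Y then Y else insert u (Y.erase (f Y u))) X
  have hcons : ∀ u l, S (u :: l) =
      if u ∈ S l then S l else insert u ((S l).erase (f (S l) u)) := fun _ _ => rfl
  have hS : ∀ l, S l ∈ 𝓕 := by
    intro l
    induction l with
    | nil => exact hX
    | cons u l ih =>
      rw [hcons]
      split_ifs with hu
      · exact ih
      · exact hf𝓕 _ ih u hu
  refine ⟨X, S, rfl, rfl, fun l u hu => ?_, fun l u hu => ?_, fun l u hu => ?_⟩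
  · exact ⟨_, hfX _ (hS l) u hu, hfG _ (hS l) u hu⟩
  · refine ⟨_, hfX _ (hS l) u hu, hfG _ (hS l) u hu, ?_⟩
    rw [hcons, if_neg hu]
    simp
  · rw [hcons, if_pos hu]

/-- A guard standing on an independent set that is attacked vertex by vertex can never answer
another attack on that set, so all its vertices end up occupied. -/
theorem EternallyGuarded.card_le_of_isIndepSet {k : ℕ} (hk : EternallyGuarded G k)
    {I : Finset V} (hI : G.IsIndepSet (I : Set V)) : I.card ≤ k := by
  classical
  obtain ⟨X, S, hX, hS⟩ := hk
  have key : ∀ l : List V, (∀ v ∈ l, v ∈ I) → (S l).card = k ∧ ∀ v ∈ l, v ∈ S l := by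
    intro l
    induction l with
    | nil => intro _; simp [hS.start, hX]
    | cons u l ih =>
      intro hl
      obtain ⟨hc, hsub⟩ := ih fun v hv => hl v (List.mem_cons_of_mem _ hv)
      by_cases hu : u ∈ S l
      · rw [hS.stay l u hu]
        refine ⟨hc, fun v hv => ?_⟩
        rcases List.mem_cons.1 hv with rfl | hv
        exacts [hu, hsub v hv]
      · obtain ⟨x, hx, hxu, hY⟩ := hS.move l u hu
        have hY' : S (u :: l) = insert u ((S l).erase x) := by
          apply Finset.coe_injective
          rw [hY]
          simp
        rw [hY']
        refine ⟨?_, fun v hv => ?_⟩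
        · rw [card_insert_of_notMem (by simp [hu]), card_erase_of_mem hx, hc]
          have := card_pos.2 ⟨x, hx⟩
          omega
        · rcases List.mem_cons.1 hv with rfl | hv'
          · exact mem_insert_self _ _
          · refine mem_insert_of_mem (mem_erase.2 ⟨?_, hsub v hv'⟩)
            rintro rfl
            exact hI (hl v hv) (hl u List.mem_cons_self) hxu.ne hxu
  obtain ⟨hc, hsub⟩ := key I.toList fun v hv => Finset.mem_toList.1 hv
  rw [← hc]
  exact card_le_card fun v hv => hsub v (Finset.mem_toList.2 hv)

theorem indepNum_le_of_eternallyGuarded [Fintype V] {k : ℕ} (hk : EternallyGuarded G k) :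
    G.indepNum ≤ k := by
  obtain ⟨s, hs⟩ := G.exists_isNIndepSet_indepNum
  rw [← hs.card_eq]
  exact hk.card_le_of_isIndepSet hs.isIndepSet

/-- If `k` guards suffice and there is an independent set of size `k`, then the independence number
and the eternal domination number both equal `k`. -/
theorem indepNum_eq_and_eternalDominationNum_eq [Fintype V] {I : Finset V}
    (hI : G.IsIndepSet (I : Set V)) (hk : EternallyGuarded G I.card) :
    G.indepNum = I.card ∧ eternalDominationNum G = I.card := by
  refine ⟨le_antisymm (indepNum_le_of_eternallyGuarded hk) hI.card_le_indepNum,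
    le_antisymm (Nat.sInf_le hk) ?_⟩
  exact le_csInf ⟨_, hk⟩ fun n hn => EternallyGuarded.card_le_of_isIndepSet hn hI

/-- A surjective colouring of the complement amounts to a partition of the vertices into nonempty
cliques; each clique can be defended by one guard that stays inside it. -/
theorem eternallyGuarded_of_coloring_compl {ι : Type*} [Fintype ι]
    (c : Gᶜ.Coloring ι) (hc : Function.Surjective c) :
    EternallyGuarded G (Fintype.card ι) := by
  classical
  have hadj : ∀ {x y}, x ≠ y → c x = c y → G.Adj x y := fun {x y} hne h => by
    by_contra hG
    exact c.valid ((compl_adj _ _ _).2 ⟨hne, hG⟩) h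
  choose r hr using hc
  have hinj : Function.Injective r := fun i j h => by rw [← hr i, h, hr]
  have hcard : (univ.image r).card = Fintype.card ι := by
    rw [card_image_of_injective _ hinj, card_univ]
  rw [← hcard]
  refine eternallyGuarded_of_closed_family {X | ∀ i, ∃! x, x ∈ X ∧ c x = i} ?_ ?_
  · intro X hX u hu
    obtain ⟨x, ⟨hxX, hxc⟩, hx⟩ := hX (c u)
    have hxu : x ≠ u := fun h => hu (h ▸ hxX)
    refine ⟨x, hxX, hadj hxu hxc, fun i => ?_⟩
    by_cases hi : i = c u
    · refine ⟨u, ⟨mem_insert_self _ _, hi.symm⟩, ?_⟩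
      rintro y ⟨hy, hyc⟩
      rcases mem_insert.1 hy with rfl | hy
      · rfl
      · exact absurd (hx y ⟨mem_of_mem_erase hy, hyc.trans hi⟩) (ne_of_mem_erase hy)
    · obtain ⟨z, ⟨hzX, hzc⟩, hz⟩ := hX i
      refine ⟨z, ⟨mem_insert_of_mem (mem_erase.2 ⟨?_, hzX⟩), hzc⟩, ?_⟩
      · rintro rfl
        exact hi (hzc.symm.trans hxc)
      · rintro y ⟨hy, hyc⟩
        rcases mem_insert.1 hy with rfl | hy
        · exact absurd hyc.symm hi
        · exact hz y ⟨mem_of_mem_erase hy, hyc⟩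
  · intro i
    refine ⟨r i, ⟨by simp, hr i⟩, ?_⟩
    rintro y ⟨hy, rfl⟩
    obtain ⟨j, -, rfl⟩ := mem_image.1 hy
    rw [hr]

theorem exists_isCliqueCover [Fintype V] (G : SimpleGraph V) : ∃ C, IsCliqueCover G C := by
  classical
  refine ⟨univ.image fun v => {v}, fun X hX => ?_, by ext; simp⟩
  obtain ⟨v, -, rfl⟩ := mem_image.1 hX
  exact isClique_singleton v

theorem card_le_of_isIndepSet_of_isCliqueCover {C : Finset (Set V)} (hC : IsCliqueCover G C)
    {I : Finset V} (hI : G.IsIndepSet (I : Set V)) :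
    I.card ≤ C.card := by
  have hcov : ∀ v, ∃ X ∈ C, v ∈ X := fun v => by
    have : v ∈ ⋃ X ∈ C, X := hC.2 ▸ Set.mem_univ v
    simpa using this
  choose f hfC hf using hcov
  refine card_le_card_of_injOn f (fun v _ => hfC v) fun v hv w hw hvw => ?_
  by_contra hne
  exact hI hv hw hne (hC.1 _ (hfC v) (hf v) (hvw ▸ hf w) hne)

/-- The colour classes of a colouring of the complement form a clique cover; together with an
independent set of the same size this determines the clique cover number. -/
theorem cliqueCoverNum_eq_of_coloring_compl {ι : Type*} [Fintype ι] (c : Gᶜ.Coloring ι)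
    {I : Finset V} (hI : G.IsIndepSet (I : Set V)) (hIc : I.card = Fintype.card ι) :
    cliqueCoverNum G = I.card := by
  classical
  have hcover : IsCliqueCover G (univ.image fun i => {v | c v = i}) := by
    refine ⟨fun X hX => ?_, ?_⟩
    · obtain ⟨i, -, rfl⟩ := mem_image.1 hX
      intro x hx y hy hne
      by_contra hG
      exact c.valid ((compl_adj _ _ _).2 ⟨hne, hG⟩) (Eq.trans hx (Eq.symm hy))
    · ext v
      simp
  have hle : cliqueCoverNum G ≤ _ := Nat.sInf_le ⟨_, hcover, rfl⟩
  refine le_antisymm (hle.trans (card_image_le.trans (by rw [card_univ, hIc]))) ?_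
  refine le_csInf ⟨_, _, hcover, rfl⟩ ?_
  rintro n ⟨C, hC, rfl⟩
  exact card_le_of_isIndepSet_of_isCliqueCover hC hI

theorem _root_.SimpleGraph.Iso.indepNum_le [Fintype V] {V' : Type*} [Fintype V'] {G' : SimpleGraph V'}
    (e : G ≃g G') : G.indepNum ≤ G'.indepNum := by
  obtain ⟨s, hs⟩ := G.exists_isNIndepSet_indepNum
  rw [← hs.card_eq, ← card_map e.toEmbedding.toEmbedding]
  refine IsIndepSet.card_le_indepNum ?_
  rintro a ha b hb hne h
  obtain ⟨x, hx, rfl⟩ := mem_map.1 (mem_coe.1 ha)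
  obtain ⟨y, hy, rfl⟩ := mem_map.1 (mem_coe.1 hb)
  exact hs.isIndepSet hx hy (ne_of_apply_ne _ hne) (e.map_rel_iff.1 h)

theorem _root_.SimpleGraph.Iso.indepNum_eq [Fintype V] {V' : Type*} [Fintype V'] {G' : SimpleGraph V'}
    (e : G ≃g G') : G.indepNum = G'.indepNum := by
  exact le_antisymm e.indepNum_le e.symm.indepNum_le

end General

/-! ### The strategy in the prism of a join with an edgeless graph -/

section Strategy

variable {U I : Type*} [DecidableEq I]

/-- The positions used to guard the prism of the join of a graph on `U` with an edgeless graph on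
`I`, where `p + 1` is the number of elements of `I`. One copy has guards on `A ⊆ U` and `B ⊆ I`, the
other on `A' ⊆ U` and `B' ⊆ I`. One copy carries `p` guards and the other `p + 1`; in each copy,
the part in `U` has at least as many guards as there are elements of `I` unoccupied in both copies;
and `p` guards in one copy of `U` must form a member of the family `𝓔`. -/
structure Safe (𝓔 : Set (Finset U)) (p : ℕ) (A : Finset U) (B : Finset I)
    (A' : Finset U) (B' : Finset I) : Prop where
  total : (#A + #B = p ∧ #A' + #B' = p + 1) ∨ (#A + #B = p + 1 ∧ #A' + #B' = p)
  reserve : p + 1 ≤ #A + #(B ∪ B')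
  reserve' : p + 1 ≤ #A' + #(B ∪ B')
  eternal : #A = p → A ∈ 𝓔
  eternal' : #A' = p → A' ∈ 𝓔

variable {𝓔 : Set (Finset U)} {p : ℕ} {A A' : Finset U} {B B' : Finset I}

theorem Safe.symm (h : Safe 𝓔 p A B A' B') : Safe 𝓔 p A' B' A B where
  total := by have := h.total; omega
  reserve := by rw [union_comm]; exact h.reserve'
  reserve' := by rw [union_comm]; exact h.reserve
  eternal := h.eternal'
  eternal' := h.eternal

theorem Safe.card_le (h : Safe 𝓔 p A B A' B') : #A ≤ p := by
  have h1 := card_union_add_card_inter B B'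
  have h2 := h.total
  have h3 := h.reserve'
  omega

/-- An attack on a vertex `u` of a copy of `U` is answered from within that copy of `U` or from the
copy of `I` on the same side. -/
theorem Safe.exists_answer_left [DecidableEq U] {F : SimpleGraph U}
    (hE₁ : ∀ X ∈ 𝓔, ∀ u ∉ X, ∃ x ∈ X, F.Adj x u ∧ insert u (X.erase x) ∈ 𝓔)
    (hE₂ : ∀ X : Finset U, #X + 1 = p → ∀ u ∉ X, insert u X ∈ 𝓔 ∨ ∃ x ∈ X, F.Adj x u)
    (h : Safe 𝓔 p A B A' B') {u : U} (hu : u ∉ A) :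
    (∃ x ∈ A, F.Adj x u ∧ Safe 𝓔 p (insert u (A.erase x)) B A' B') ∨
      ∃ v ∈ B, Safe 𝓔 p (insert u A) (B.erase v) A' B' := by
  have hA := h.card_le
  have htot := h.total
  have hcard : ∀ x ∈ A, #(insert u (A.erase x)) = #A := fun x hx => by
    rw [card_insert_of_notMem (by simp [hu]), card_erase_add_one hx]
  -- A move inside the copy of `U` only has to respect the condition on `𝓔`.
  have hinside : ∀ x ∈ A, (#A = p → insert u (A.erase x) ∈ 𝓔) →
      Safe 𝓔 p (insert u (A.erase x)) B A' B' := fun x hx hE =>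
    ⟨by rw [hcard x hx]; exact htot, by rw [hcard x hx]; exact h.reserve, h.reserve',
      fun hp => hE (by rwa [hcard x hx] at hp), h.eternal'⟩
  by_cases hAp : #A = p
  · obtain ⟨x, hx, hxu, hE⟩ := hE₁ A (h.eternal hAp) u hu
    exact .inl ⟨x, hx, hxu, hinside x hx fun _ => hE⟩
  by_cases hAE : #A + 1 = p → insert u A ∈ 𝓔
  · right
    have hunion := card_union_add_card_inter B B'
    have hr := h.reserve
    have hr' := h.reserve'
    have hB : B.Nonempty := card_pos.1 (by omega)
    obtain ⟨v, hv, hv', hv''⟩ : ∃ v ∈ B, p + 1 ≤ #A' + #(B.erase v ∪ B') ∧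
        #(B ∪ B') ≤ #(B.erase v ∪ B') + 1 := by
      have hle : ∀ v, #(B ∪ B') ≤ #(B.erase v ∪ B') + 1 := fun v => by
        refine (card_le_card ?_).trans (card_insert_le v _)
        intro w
        simp only [mem_union, mem_insert, mem_erase]
        tauto
      by_cases hslack : p + 2 ≤ #A' + #(B ∪ B')
      · obtain ⟨v, hv⟩ := hB
        refine ⟨v, hv, ?_, hle v⟩
        have := hle v
        omega
      · -- Without slack on the other side, some element of `I` is occupied in both copies.
        obtain ⟨v, hv⟩ : (B ∩ B').Nonempty := card_pos.1 (by omega)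
        obtain ⟨hvB, hvB'⟩ := mem_inter.1 hv
        refine ⟨v, hvB, ?_, hle v⟩
        have : B.erase v ∪ B' = B ∪ B' := by
          ext w
          simp only [mem_union, mem_erase]
          by_cases hw : w = v
          · simp [hw, hvB']
          · simp [hw]
        rwa [this]
    have hB1 := card_erase_add_one hv
    have hA1 := card_insert_of_notMem hu
    exact ⟨v, hv, by omega, by omega, hv', fun hp => hAE (by omega), h.eternal'⟩
  · left
    push Not at hAE
    obtain ⟨x, hx, hxu⟩ := (hE₂ A hAE.1 u hu).resolve_left hAE.2
    exact ⟨x, hx, hxu, hinside x hx fun hp => absurd hp hAp⟩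

/-- An attack on a vertex `v` of a copy of `I` is answered from the other copy of `v` or from the
copy of `U` on the same side. -/
theorem Safe.exists_answer_right [DecidableEq U] [Fintype I] (hI : Fintype.card I = p + 1)
    (h : Safe 𝓔 p A B A' B') {v : I} (hv : v ∉ B) :
    (v ∈ B' ∧ Safe 𝓔 p A (insert v B) A' (B'.erase v)) ∨
      ∃ x ∈ A, Safe 𝓔 p (A.erase x) (insert v B) A' B' := by
  have hA := h.card_le
  have htot := h.total
  have hr := h.reserve
  have hr' := h.reserve'
  have hB1 := card_insert_of_notMem hv
  have hlt : ∀ s : Finset I, v ∉ s → #s < p + 1 := fun s hs => by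
    rw [← hI, ← card_univ]
    exact card_lt_card ((ssubset_univ_iff).2 fun h => hs (h ▸ mem_univ v))
  have hun : insert v B ∪ B' = insert v (B ∪ B') := insert_union _ _ _
  by_cases hv' : v ∈ B'
  · have hvu : insert v (B ∪ B') = B ∪ B' := insert_eq_of_mem (mem_union_right _ hv')
    rcases htot with ⟨ht, ht'⟩ | ⟨ht, ht'⟩
    · left
      have hB'1 := card_erase_add_one hv'
      have : insert v B ∪ B'.erase v = B ∪ B' := by
        rw [← hvu]
        ext w
        simp only [mem_union, mem_insert, mem_erase]
        tauto
      exact ⟨hv', by omega, by rwa [this], by rwa [this], h.eternal, h.eternal'⟩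
    · right
      -- Some occupied element of `I` is missing from `B`, so this side has a guard to spare in `U`.
      have hBlt : #B < #(B ∪ B') :=
        card_lt_card ⟨subset_union_left, fun hs => hv (hs (mem_union_right _ hv'))⟩
      have := hlt B hv
      obtain ⟨x, hx⟩ : A.Nonempty := card_pos.1 (by omega)
      have hA1 := card_erase_add_one hx
      refine ⟨x, hx, by omega, ?_, ?_, by omega, h.eternal'⟩ <;> rw [hun, hvu] <;> omega
  · right
    have hvu : v ∉ B ∪ B' := by simp [hv, hv']
    have := hlt _ hvu
    obtain ⟨x, hx⟩ : A.Nonempty := card_pos.1 (by omega)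
    have hA1 := card_erase_add_one hx
    have hU1 := card_insert_of_notMem hvu
    refine ⟨x, hx, by omega, ?_, ?_, by omega, h.eternal'⟩ <;> rw [hun, hU1] <;> omega

variable [Fintype U] [Fintype I] [DecidableEq U]

/-- The part in `U` of copy `j` of a set of vertices of the prism of a graph on `U ⊕ I`. -/
def leftLayer (X : Finset ((U ⊕ I) × Fin 2)) (j : Fin 2) : Finset U := {x | (.inl x, j) ∈ X}

/-- The part in `I` of copy `j` of a set of vertices of the prism of a graph on `U ⊕ I`. -/
def rightLayer (X : Finset ((U ⊕ I) × Fin 2)) (j : Fin 2) : Finset I := {v | (.inr v, j) ∈ X}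

/-- Let `R` be the complement of a graph `F` whose `p`-subsets in `𝓔` can be defended forever. If
any `p - 1` guards on `F` either dominate an attacked vertex or become a member of `𝓔` on adding
it, then `2 * p + 1` guards can defend the prism of the join of `F` with an edgeless graph on
`p + 1` vertices. -/
theorem eternallyGuarded_prism_compl_sum {R : SimpleGraph U} {𝓔 : Set (Finset U)} {p : ℕ}
    (hE₁ : ∀ X ∈ 𝓔, ∀ u ∉ X, ∃ x ∈ X, Rᶜ.Adj x u ∧ insert u (X.erase x) ∈ 𝓔)
    (hE₂ : ∀ X : Finset U, #X + 1 = p → ∀ u ∉ X, insert u X ∈ 𝓔 ∨ ∃ x ∈ X, Rᶜ.Adj x u)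
    (hI : Fintype.card I = p + 1) (X : Finset ((U ⊕ I) × Fin 2))
    (hX : Safe 𝓔 p (leftLayer X 0) (rightLayer X 0) (leftLayer X 1) (rightLayer X 1)) :
    EternallyGuarded (prism (R ⊕g (⊤ : SimpleGraph I))ᶜ) (#X) := by
  have hfin : ∀ i j k : Fin 2, i ≠ j → k ≠ i → k = j := by decide
  refine eternallyGuarded_of_closed_family {X | ∀ i j : Fin 2, i ≠ j →
    Safe 𝓔 p (leftLayer X i) (rightLayer X i) (leftLayer X j) (rightLayer X j)} ?_ ?_
  · intro X hX w hw
    obtain ⟨i, hi⟩ : ∃ i, w.2 = i := ⟨_, rfl⟩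
    obtain ⟨j, hij⟩ : ∃ j, i ≠ j := by
      clear hi
      revert i
      decide
    -- It suffices to consider the two copies in the order that puts the attacked one first.
    have hsuff : ∀ Y : Finset ((U ⊕ I) × Fin 2),
        Safe 𝓔 p (leftLayer Y i) (rightLayer Y i) (leftLayer Y j) (rightLayer Y j) →
        ∀ i j : Fin 2, i ≠ j →
          Safe 𝓔 p (leftLayer Y i) (rightLayer Y i) (leftLayer Y j) (rightLayer Y j) := by
      intro Y hY i' j' hij'
      by_cases h : i' = i
      · subst h
        rwa [hfin i' j j' hij hij'.symm]
      · obtain rfl := hfin i j i' hij h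
        rw [hfin i' i j' hij.symm hij'.symm]
        exact hY.symm
    obtain ⟨u | v, i⟩ := w <;> obtain rfl := hi
    · have huA : u ∉ leftLayer X i := by simpa [leftLayer] using hw
      rcases (hX i j hij).exists_answer_left hE₁ hE₂ huA with ⟨x, hx, hxu, hS⟩ | ⟨v, hv, hS⟩
      · refine ⟨(.inl x, i), by simpa [leftLayer] using hx, ?_, hsuff _ ?_⟩
        · simpa [boxProd_adj] using hxu
        · convert hS using 1 <;> ext w <;> simp [leftLayer, rightLayer, hij.symm]
      · refine ⟨(.inr v, i), by simpa [rightLayer] using hv, ?_, hsuff _ ?_⟩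
        · simp [boxProd_adj]
        · convert hS using 1 <;> ext w <;> simp [leftLayer, rightLayer, hij.symm]
    · have hvB : v ∉ rightLayer X i := by simpa [rightLayer] using hw
      rcases (hX i j hij).exists_answer_right hI hvB with ⟨hv', hS⟩ | ⟨x, hx, hS⟩
      · refine ⟨(.inr v, j), by simpa [rightLayer] using hv', ?_, hsuff _ ?_⟩
        · simp [boxProd_adj, hij.symm]
        · convert hS using 1 <;> ext w <;> simp [leftLayer, rightLayer, hij.symm, hij]
      · refine ⟨(.inl x, i), by simpa [leftLayer] using hx, ?_, hsuff _ ?_⟩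
        · simp [boxProd_adj]
        · convert hS using 1 <;> ext w <;> simp [leftLayer, rightLayer, hij.symm]
  · intro i j hij
    obtain ⟨rfl, rfl⟩ | ⟨rfl, rfl⟩ : i = 0 ∧ j = 1 ∨ i = 1 ∧ j = 0 := by
      revert i j; decide
    exacts [hX, hX.symm]

end Strategy

/-! ### Cliques and independent sets in the prism -/

section Prism

variable {U I W : Type*} [Fintype I] [DecidableEq I]

theorem isIndepSet_prism_compl_sum [DecidableEq U] {R : SimpleGraph U} {K : Finset U}
    (hK : R.IsClique (K : Set U)) :
    (prism (R ⊕g (⊤ : SimpleGraph I))ᶜ).IsIndepSet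
      (((univ.image fun v : I => ((.inr v, 0) : (U ⊕ I) × Fin 2)) ∪
        K.image fun x => (.inl x, 1) : Finset ((U ⊕ I) × Fin 2)) : Set ((U ⊕ I) × Fin 2)) := by
  rintro a ha b hb hne
  simp only [coe_union, coe_image, coe_univ, Set.mem_union, Set.mem_image, Set.mem_univ,
    true_and, mem_coe] at ha hb
  rcases ha with ⟨v, rfl⟩ | ⟨x, hx, rfl⟩ <;> rcases hb with ⟨w, rfl⟩ | ⟨y, hy, rfl⟩
  · simp [boxProd_adj]
  · simp [boxProd_adj]
  · simp [boxProd_adj]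
  · have hxy : x ≠ y := by rintro rfl; exact hne rfl
    simp [boxProd_adj, hK hx hy hxy]

theorem card_image_inr_union_image_inl [DecidableEq U] (K : Finset U) :
    #((univ.image fun v : I => ((.inr v, 0) : (U ⊕ I) × Fin 2)) ∪
        K.image fun x => (.inl x, 1)) = Fintype.card I + #K := by
  rw [card_union_of_disjoint, card_image_of_injective, card_image_of_injective, card_univ]
  · intro x y h; simpa using h
  · intro x y h; simpa using h
  · rw [Finset.disjoint_left]
    simp

/-- Every clique cover of the prism has at least `|I|` cliques meeting one copy of `I`, and as many
cliques meeting the other copy of `W` as are needed to colour `H`; no clique is of both kinds. -/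
theorem card_add_lt_of_isCliqueCover_prism {H : SimpleGraph W} {R : SimpleGraph U} (f : H ↪g R)
    {n : ℕ} (hH : ¬ H.Colorable n)
    {C : Finset (Set ((U ⊕ I) × Fin 2))}
    (hC : IsCliqueCover (prism (R ⊕g (⊤ : SimpleGraph I))ᶜ) C) :
    Fintype.card I + n < #C := by
  classical
  have hcov : ∀ v, ∃ X ∈ C, v ∈ X := fun v => by
    have : v ∈ ⋃ X ∈ C, X := hC.2 ▸ Set.mem_univ v
    simpa using this
  choose g hgC hg using hcov
  have hclique : ∀ {a b}, g a = g b → a ≠ b → (prism (R ⊕g (⊤ : SimpleGraph I))ᶜ).Adj a b :=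
    fun {a b} h hne => hC.1 _ (hgC a) (hg a) (h ▸ hg b) hne
  let C₀ := univ.image fun v : I => g (.inr v, 0)
  let C₁ := {X ∈ C | ∃ w : W, g (.inl (f w), 1) = X}
  have h₀ : #C₀ = Fintype.card I := by
    rw [card_image_of_injective, card_univ]
    intro v w h
    by_contra hne
    simpa [boxProd_adj] using hclique h (by simpa using hne)
  have h₁ : n < #C₁ := by
    by_contra hle
    refine hH (Colorable.mono (not_lt.1 hle) ?_)
    rw [← Fintype.card_coe]
    refine Coloring.colorable (α := C₁)
      (Coloring.mk (fun w => ⟨g (.inl (f w), 1), by simp [C₁, hgC]⟩) ?_)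
    intro x y hxy h
    have hne : f x ≠ f y := f.injective.ne hxy.ne
    have := hclique (congrArg Subtype.val h) (by simpa using hne)
    simp [boxProd_adj, f.map_adj_iff.2 hxy] at this
  have hdisj : Disjoint C₀ C₁ := by
    rw [Finset.disjoint_left]
    intro X hX₀ hX₁
    obtain ⟨v, -, rfl⟩ := mem_image.1 hX₀
    obtain ⟨-, w, hw⟩ := mem_filter.1 hX₁
    simpa [boxProd_adj] using hclique hw (by simp)
  have hsub : C₀ ∪ C₁ ⊆ C := by
    refine union_subset ?_ (filter_subset _ _)
    intro X hX
    obtain ⟨v, -, rfl⟩ := mem_image.1 hX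
    exact hgC _
  have := card_le_card hsub
  rw [card_union_of_disjoint hdisj] at this
  omega

/-- The initial position: all of `I` in one copy and `K` in the other. -/
theorem safe_start [DecidableEq U] [Fintype U] {𝓔 : Set (Finset U)} {p : ℕ} {K : Finset U} (hE : K ∈ 𝓔)
    (hK : #K = p) (hp : p ≠ 0) (hI : Fintype.card I = p + 1)
    {X : Finset ((U ⊕ I) × Fin 2)}
    (hX : X = (univ.image fun v : I => (.inr v, 0)) ∪ K.image fun x => (.inl x, 1)) :
    Safe 𝓔 p (leftLayer X 0) (rightLayer X 0) (leftLayer X 1) (rightLayer X 1) := by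
  have e1 : leftLayer X 0 = ∅ := by ext; simp [hX, leftLayer]
  have e2 : rightLayer X 0 = univ := by ext; simp [hX, rightLayer]
  have e3 : leftLayer X 1 = K := by ext; simp [hX, leftLayer]
  have e4 : rightLayer X 1 = ∅ := by ext; simp [hX, rightLayer]
  rw [e1, e2, e3, e4]
  exact ⟨.inr (by simp [hI, hK]), by simp [hI], by simp [hI],
    fun h => absurd h.symm (by simpa using hp), fun _ => hE⟩

end Prism

/-! ### Triangle-free graphs of given chromatic number -/

section Mycielskian

variable {W : Type*}

/-- The Mycielskian of `H`: the vertices are those of `H` (first summand), a twin of each (second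
summand) adjacent to the neighbours of its original in `H`, and an apex `none` adjacent to all
twins. -/
def mycielskian (H : SimpleGraph W) : SimpleGraph (Option (W ⊕ W)) where
  Adj
    | some (.inl x), some (.inl y) => H.Adj x y
    | some (.inl x), some (.inr y) => H.Adj x y
    | some (.inr x), some (.inl y) => H.Adj x y
    | some (.inr _), none => True
    | none, some (.inr _) => True
    | _, _ => False
  symm := ⟨by rintro (_ | x | x) (_ | y | y) h <;> first | exact h.symm | exact h⟩
  loopless := ⟨by rintro (_ | x | x) h <;> first | exact H.loopless.irrefl _ h | exact h⟩

theorem cliqueFree_three_iff_forall {H : SimpleGraph W} :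
    H.CliqueFree 3 ↔ ∀ x y z, H.Adj x y → H.Adj x z → ¬ H.Adj y z := by
  classical
  constructor
  · intro h x y z hxy hxz hyz
    exact h {x, y, z} (is3Clique_triple_iff.2 ⟨hxy, hxz, hyz⟩)
  · intro h s hs
    obtain ⟨x, y, z, hxy, hxz, hyz, -⟩ := is3Clique_iff.1 hs
    exact h x y z hxy hxz hyz

theorem cliqueFree_three_mycielskian {H : SimpleGraph W} (hH : H.CliqueFree 3) :
    (mycielskian H).CliqueFree 3 := by
  rw [cliqueFree_three_iff_forall] at hH ⊢
  rintro (_ | x | x) (_ | y | y) (_ | z | z) <;> simp only [mycielskian] <;>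
    first | exact hH x y z | tauto

theorem colorable_mycielskian {H : SimpleGraph W} {n : ℕ} (hH : H.Colorable (n + 1)) :
    (mycielskian H).Colorable (n + 2) := by
  obtain ⟨c⟩ := hH
  refine ⟨Coloring.mk
    (fun v => v.elim (Fin.last _) fun w => (Sum.elim c c w).castSucc) ?_⟩
  rintro (_ | x | x) (_ | y | y) h <;>
    first
    | exact h.elim
    | exact (Fin.castSucc_lt_last _).ne
    | exact (Fin.castSucc_lt_last _).ne'
    | exact fun h' => c.valid h (Fin.castSucc_injective _ h')

/-- Given a colouring of the Mycielskian, recolour the vertices of `H` that have the colour of the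
apex by the colours of their twins; this saves a colour. -/
theorem colorable_of_colorable_mycielskian {H : SimpleGraph W} {n : ℕ}
    (h : (mycielskian H).Colorable (n + 1)) : H.Colorable n := by
  obtain ⟨c⟩ := h
  have hcard : Fintype.card {i // i ≠ c none} = n := by simp
  rw [← hcard]
  refine Coloring.colorable (Coloring.mk (fun x =>
    if hx : c (some (.inl x)) = c none then ⟨c (some (.inr x)), c.valid ?_⟩ else ⟨_, hx⟩) ?_)
  · trivial
  · intro x y hxy
    have h₁ : c (some (.inl x)) ≠ c (some (.inl y)) := c.valid hxy
    have h₂ : c (some (.inl x)) ≠ c (some (.inr y)) := c.valid hxy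
    have h₃ : c (some (.inr x)) ≠ c (some (.inl y)) := c.valid hxy
    grind

theorem exists_cliqueFree_three_colorable_not_colorable (n : ℕ) :
    ∃ (W : Type) (_ : Fintype W) (H : SimpleGraph W),
      H.CliqueFree 3 ∧ H.Colorable (n + 1) ∧ ¬ H.Colorable n := by
  induction n with
  | zero =>
    refine ⟨Unit, inferInstance, ⊥, cliqueFree_bot (by norm_num), ⟨Coloring.mk (fun _ => 0) ?_⟩, ?_⟩
    · simp
    · rintro ⟨c⟩
      exact (c ()).elim0
  | succ n ih =>
    obtain ⟨W, _, H, h3, hn, hn'⟩ := ih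
    exact ⟨_, inferInstance, mycielskian H, cliqueFree_three_mycielskian h3,
      colorable_mycielskian hn, fun h => hn' (colorable_of_colorable_mycielskian h)⟩

end Mycielskian

/-! ### The counterexamples -/

section Join

variable {W : Type*} [DecidableEq W] {H : SimpleGraph W} {p : ℕ}

/-- The sets of `p` vertices of the join of `Hᶜ` with an edgeless graph on `p` vertices that are
not cliques of `Hᶜ`. -/
def guardSets (H : SimpleGraph W) (p : ℕ) : Set (Finset (W ⊕ Fin p)) :=
  {X | #X = p ∧ ((∃ k, .inr k ∈ X) ∨ ∃ a b, .inl a ∈ X ∧ .inl b ∈ X ∧ H.Adj a b)}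

/-- If `p` vertices do not form a member of `guardSets H p`, they form a clique of `Hᶜ`; hence any
of them can move to any other. -/
theorem exists_adj_of_insert_notMem_guardSets {X : Finset (W ⊕ Fin p)} {u : W ⊕ Fin p}
    (hcard : #(insert u X) = p) (hX : X.Nonempty) (hu : u ∉ X)
    (h : insert u X ∉ guardSets H p) :
    ∃ x ∈ X, (H ⊕g (⊤ : SimpleGraph (Fin p)))ᶜ.Adj x u := by
  simp only [guardSets, Set.mem_ofPred_eq, hcard, true_and, not_or, not_exists] at h
  obtain ⟨x, hx⟩ := hX
  refine ⟨x, hx, ?_⟩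
  have hxu : x ≠ u := fun h => hu (h ▸ hx)
  rcases x with x | x
  · rcases u with u | u
    · have := h.2 x u
      simp_all
    · exact absurd (mem_insert_self _ _) (h.1 u)
  · exact absurd (mem_insert_of_mem hx) (h.1 x)

/-- For triangle-free `H`, an attack on a position in `guardSets H p` can always be answered. -/
theorem exists_answer_guardSets (hH : H.CliqueFree 3) (hp : 3 ≤ p) {X : Finset (W ⊕ Fin p)}
    (hX : X ∈ guardSets H p) {u : W ⊕ Fin p} (hu : u ∉ X) :
    ∃ x ∈ X, (H ⊕g (⊤ : SimpleGraph (Fin p)))ᶜ.Adj x u ∧ insert u (X.erase x) ∈ guardSets H p := by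
  obtain ⟨hcard, hX⟩ := hX
  have hcard' : ∀ x ∈ X, #(insert u (X.erase x)) = p := fun x hx => by
    rw [card_insert_of_notMem (by simp [hu]), card_erase_add_one hx, hcard]
  rcases u with u | u
  · by_cases hk : ∃ k, .inr k ∈ X
    · obtain ⟨k, hk⟩ := hk
      by_cases hE : insert (.inl u) (X.erase (.inr k)) ∈ guardSets H p
      · exact ⟨_, hk, by simp, hE⟩
      · -- The remaining guards form a clique of `Hᶜ` with `u`; move one of them and keep `k`.
        have hne : (X.erase (.inr k)).Nonempty := by
          have := card_erase_add_one hk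
          exact card_pos.1 (by omega)
        obtain ⟨y, hy, hyu⟩ := exists_adj_of_insert_notMem_guardSets (hcard' _ hk) hne
          (by simp [hu]) hE
        exact ⟨y, mem_of_mem_erase hy, hyu, hcard' y (mem_of_mem_erase hy),
          .inl ⟨k, mem_insert_of_mem (mem_erase.2 ⟨(ne_of_mem_erase hy).symm, hk⟩)⟩⟩
    · obtain ⟨a, b, ha, hb, hab⟩ := hX.resolve_left hk
      obtain ⟨c, hc⟩ : ((X.erase (.inl a)).erase (.inl b)).Nonempty := by
        have h1 := card_erase_add_one ha
        have h2 := card_erase_add_one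
          (mem_erase.2 ⟨by simpa using hab.ne', hb⟩ : Sum.inl b ∈ X.erase (.inl a))
        exact card_pos.1 (by omega)
      simp only [mem_erase] at hc
      obtain ⟨hcb, hca, hcX⟩ := hc
      rcases c with c | c
      swap
      · exact absurd ⟨c, hcX⟩ hk
      have hne : ∀ {x : W}, .inl x ∈ X → x ≠ u := fun {x} hx h => hu (h ▸ hx)
      by_cases hcu : H.Adj c u
      · -- As `H` is triangle-free, `u` is not `H`-adjacent to both `a` and `b`.
        have key : ∀ a, Sum.inl a ∈ X → (Sum.inl c : W ⊕ Fin p) ≠ .inl a → ¬ H.Adj a u →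
            ∃ x ∈ X, (H ⊕g (⊤ : SimpleGraph (Fin p)))ᶜ.Adj x (.inl u) ∧
              insert (.inl u) (X.erase x) ∈ guardSets H p := fun a ha hca hau =>
          ⟨.inl a, ha, by simp [hne ha, hau], hcard' _ ha, .inr ⟨c, u,
            mem_insert_of_mem (mem_erase.2 ⟨hca, hcX⟩), mem_insert_self _ _, hcu⟩⟩
        by_cases hau : H.Adj a u
        · exact key b hb hcb fun hbu =>
            cliqueFree_three_iff_forall.1 hH a b u hab hau hbu
        · exact key a ha hca hau
      · exact ⟨.inl c, hcX, by simp [hne hcX, hcu], hcard' _ hcX, .inr ⟨a, b,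
          mem_insert_of_mem (mem_erase.2 ⟨hca.symm, ha⟩),
          mem_insert_of_mem (mem_erase.2 ⟨hcb.symm, hb⟩), hab⟩⟩
  · obtain ⟨x, hx⟩ : ∃ x, Sum.inl x ∈ X := by
      -- Otherwise the `p` guards occupy all vertices outside `W`, among them the attacked one.
      by_contra! hno
      have hsub : X ⊆ (univ.image Sum.inr).erase (.inr u) := by
        intro y hy
        rcases y with y | y
        · exact absurd hy (hno y)
        · refine mem_erase.2 ⟨?_, by simp⟩
          rintro h
          exact hu (h ▸ hy)
      have h1 := card_le_card hsub
      rw [card_erase_of_mem (by simp), card_image_of_injective _ Sum.inr_injective] at h1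
      simp at h1
      omega
    exact ⟨_, hx, by simp, hcard' _ hx, .inl ⟨u, mem_insert_self _ _⟩⟩

end Join

/-- For every `m ≥ 4` there is a counterexample with eternal domination number `m`. Take `H`
triangle-free with chromatic number `m`, and join its complement with edgeless graphs on `m - 1`
and on `m` vertices. -/
theorem exists_counterexample (p : ℕ) (hp : 3 ≤ p) :
    ∃ (V : Type) (_ : Fintype V) (G : SimpleGraph V),
      G.indepNum = p + 1 ∧ eternalDominationNum G = p + 1 ∧ cliqueCoverNum G = p + 1 ∧
      (prism G).indepNum = eternalDominationNum (prism G) ∧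
      eternalDominationNum (prism G) < cliqueCoverNum (prism G) := by
  classical
  obtain ⟨W, _, H, h3, ⟨cH⟩, hn'⟩ := exists_cliqueFree_three_colorable_not_colorable p
  let R : SimpleGraph (W ⊕ Fin p) := H ⊕g ⊤
  let c : (R ⊕g (⊤ : SimpleGraph (Fin (p + 1)))).Coloring (Fin (p + 1)) :=
    (cH.sum (Coloring.mk Fin.castSucc (by simp))).sum (Coloring.mk id (by simp))
  have hcsurj : Function.Surjective c := fun i => ⟨.inr i, rfl⟩
  let c' : ((R ⊕g (⊤ : SimpleGraph (Fin (p + 1))))ᶜ)ᶜ.Coloring (Fin (p + 1)) :=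
    c.comp (Iso.refl.toHom.comp (Hom.ofLE (compl_compl _).le))
  have hI : ((R ⊕g (⊤ : SimpleGraph (Fin (p + 1))))ᶜ).IsIndepSet
      ((univ.image Sum.inr : Finset ((W ⊕ Fin p) ⊕ Fin (p + 1))) : Set _) := by
    intro a ha b hb hne
    simp only [coe_image, coe_univ, Set.image_univ, Set.mem_range] at ha hb
    obtain ⟨v, rfl⟩ := ha
    obtain ⟨w, rfl⟩ := hb
    have : v ≠ w := fun h => hne (h ▸ rfl)
    simp [this]
  have hIc : #(univ.image Sum.inr : Finset ((W ⊕ Fin p) ⊕ Fin (p + 1))) = p + 1 := by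
    rw [card_image_of_injective _ Sum.inr_injective, card_univ, Fintype.card_fin]
  have hguard := eternallyGuarded_of_coloring_compl c' hcsurj
  rw [Fintype.card_fin] at hguard
  obtain ⟨h1, h2⟩ := indepNum_eq_and_eternalDominationNum_eq hI (by rwa [hIc])
  have h4 := cliqueCoverNum_eq_of_coloring_compl c' hI (by simpa using hIc)
  rw [hIc] at h1 h2 h4
  let K : Finset (W ⊕ Fin p) := univ.image Sum.inr
  have hK : R.IsClique (K : Set (W ⊕ Fin p)) := by
    intro a ha b hb hne
    simp only [K, coe_image, coe_univ, Set.image_univ, Set.mem_range] at ha hb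
    obtain ⟨v, rfl⟩ := ha
    obtain ⟨w, rfl⟩ := hb
    have : v ≠ w := fun h => hne (h ▸ rfl)
    simp [R, this]
  have hKc : #K = p := by
    rw [card_image_of_injective _ Sum.inr_injective, card_univ, Fintype.card_fin]
  have hKE : K ∈ guardSets H p := ⟨hKc, .inl ⟨⟨0, by omega⟩, by simp [K]⟩⟩
  have hguard' := eternallyGuarded_prism_compl_sum (I := Fin (p + 1)) (R := R)
    (𝓔 := guardSets H p) (p := p) (fun X hX u hu => exists_answer_guardSets h3 hp hX hu)
    (fun X hX u hu => by
      by_cases hE : insert u X ∈ guardSets H p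
      · exact .inl hE
      · exact .inr (exists_adj_of_insert_notMem_guardSets
          (by rw [card_insert_of_notMem hu, hX]) (card_pos.1 (by omega)) hu hE))
    (by simp)
    _ (safe_start hKE hKc (by omega) (by simp) rfl)
  obtain ⟨h5, h6⟩ := indepNum_eq_and_eternalDominationNum_eq
    (isIndepSet_prism_compl_sum (I := Fin (p + 1)) hK) hguard'
  refine ⟨_, inferInstance, (R ⊕g (⊤ : SimpleGraph (Fin (p + 1))))ᶜ, h1, h2, h4,
    h5.trans h6.symm, ?_⟩
  rw [h6, card_image_inr_union_image_inl, hKc, ← Nat.add_one_le_iff]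
  refine le_csInf ?_ ?_
  · obtain ⟨C, hC⟩ := exists_isCliqueCover (prism (R ⊕g (⊤ : SimpleGraph (Fin (p + 1))))ᶜ)
    exact ⟨_, C, hC, rfl⟩
  · rintro n ⟨C, hC, rfl⟩
    exact card_add_lt_of_isCliqueCover_prism (H := H) Embedding.sumInl hn' hC

end EternalDomination

theorem mainTheorem1 :
    (∀ k : ℕ, 2 ≤ k →
      ∃ (V : Type) (_ : Fintype V) (G : SimpleGraph V),
        G.indepNum = Nat.choose (k + 1) 2 + 1 ∧
        EternalDomination.eternalDominationNum G = Nat.choose (k + 1) 2 + 1 ∧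
        EternalDomination.cliqueCoverNum G = Nat.choose (k + 1) 2 + 1 ∧
        (EternalDomination.prism G).indepNum =
          EternalDomination.eternalDominationNum (EternalDomination.prism G) ∧
        EternalDomination.eternalDominationNum (EternalDomination.prism G) <
          EternalDomination.cliqueCoverNum (EternalDomination.prism G)) ∧
    (∃ (V : ℕ → Type) (_ : ∀ i, Fintype (V i)) (G : ∀ i, SimpleGraph (V i)),
      (∀ i j, i ≠ j → IsEmpty (G i ≃g G j)) ∧
      ∀ i,
        EternalDomination.eternalDominationNum (G i) = EternalDomination.cliqueCoverNum (G i) ∧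
        EternalDomination.eternalDominationNum (EternalDomination.prism (G i)) <
          EternalDomination.cliqueCoverNum (EternalDomination.prism (G i))) := by
  refine ⟨fun k hk => EternalDomination.exists_counterexample _ ?_, ?_⟩
  · exact (by decide : 3 ≤ Nat.choose 3 2).trans (Nat.choose_le_choose 2 (by omega))
  · choose V hV G h₁ h₂ h₃ _ h₅ using
      fun i : ℕ => EternalDomination.exists_counterexample (i + 3) (by omega)
    refine ⟨V, hV, G, fun i j hij => ⟨fun e => hij ?_⟩, fun i => ⟨(h₂ i).trans (h₃ i).symm, h₅ i⟩⟩
    have := e.indepNum_eq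
    rw [h₁, h₁] at this
    omega
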